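/- For $t\in\mathbb{R}$ let $\|t\|$ denote the distance from $t$ to the nearest integer. Let $d\ge 1$, let $\mathcal R=\{r\in\mathbb{R}^d : r_i\ge 0,\ \sum_i r_i=1\}$, and for $r\in\mathcal R$ and $x\in\mathbb{R}^d$ put $$\|x\|_r=\Big(\max_{1\le i\le d}\|x_i\|^{1/r_i}\Big)^{1/d},$$ where $\|x_i\|^{1/r_i}$ is read as $0$ if $r_i=0$. Let $\mathcal D$ be the set of all non-increasing functions $\psi:\{1,2,3,\dots\}\to[0,\infty)$ for which $\sum_{n\ge1}\psi(n)^d$ diverges. Define $$\Pi_r=\bigcap_{\psi\in\mathcal D}\big\{(x,y)\in\mathbb{R}^d\times\mathbb{R}^d : \|nx+y\|_r<\psi(n)\ \text{for infinitely many integers } n\ge 1\big\},$$ and, for $x\in\mathbb{R}^d$, $\Phi_r(x)=\{y\in\mathbb{R}^d : (x,y)\in\Pi_r\}$. Theorem. For every $r\in\mathcal R$ the set $\Pi_r\subset\mathbb{R}^d\times\mathbb{R}^d$ is Lebesgue measurable and has Lebesgue measure $0$. In fact, for every $x\in\mathbb{R}^d$, the set $\Phi_r(x)\subset\mathbb{R}^d$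 has ($d$-dimensional) Lebesgue measure $0$. -/

import Mathlib

open MeasureTheory
open scoped NNReal

noncomputable section

namespace WeightedApprox

/-- `‖t‖`: the distance from a real number to the nearest integer. -/
def distInt (t : ℝ) : ℝ := |t - (round t : ℝ)|

/-- The weighted size `‖x‖_r = (max_i ‖x_i‖ ^ (1 / r_i)) ^ (1 / d)`.  Since `0 ≤ ‖t‖ ≤ 1/2`, the
expression `‖t‖ ^ (1 / 0) = ‖t‖ ^ ∞` is read as `0`, the standard convention for weights that
may vanish. -/
def wnorm {d : ℕ} (r x : Fin d → ℝ) : ℝ :=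
  (⨆ i : Fin d, if r i = 0 then 0 else distInt (x i) ^ (1 / r i)) ^ (1 / (d : ℝ))

/-- The class `𝒟` of non-increasing `ψ : {1, 2, 3, …} → [0, ∞)` for which `∑ ψ(n) ^ d` diverges.
The value `ψ 0` is irrelevant. -/
def rates (d : ℕ) : Set (ℕ → ℝ≥0) :=
  {ψ | AntitoneOn ψ {n | 1 ≤ n} ∧ ¬ Summable fun n => ψ n ^ d}

/-- `W(r, ψ)`: the pairs `(x, y)` with `‖n x + y‖_r < ψ(n)` for infinitely many positive
integers `n`. -/
def W {d : ℕ} (r : Fin d → ℝ) (ψ : ℕ → ℝ≥0) : Set ((Fin d → ℝ) × (Fin d → ℝ)) :=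
  {p | {n : ℕ | 1 ≤ n ∧ wnorm r ((n : ℝ) • p.1 + p.2) < (ψ n : ℝ)}.Infinite}

/-- `Π_r`: the pairs that are approximable at every rate in `𝒟`. -/
def PiSet {d : ℕ} (r : Fin d → ℝ) : Set ((Fin d → ℝ) × (Fin d → ℝ)) :=
  ⋂ ψ ∈ rates d, W r ψ

/-- `Φ_r(x)`: the vertical fiber of `Π_r` over `x`. -/
def PhiSet {d : ℕ} (r x : Fin d → ℝ) : Set (Fin d → ℝ) :=
  {y | (x, y) ∈ PiSet r}

end WeightedApprox

end

open Filter Topology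

namespace WeightedApprox

/-! Each pair is tested against a rate built from itself, its running minimum `ψ`. This `ψ` is
non-increasing and no `n` satisfies `‖n x + y‖_r < ψ n`, so for a pair in `Π_r` the series `∑ ψ(n) ^
d` must converge (`summable_runningMin_pow_of_mem_PiSet`). Cauchy condensation then forces `2 ^ k *
ψ(2 ^ k) ^ d → 0`. For fixed `x`, a union bound over `m ≤ 2 ^ k` shows that this quantity is below
`c` only on a set of measure `O(c)` in each unit cube, uniformly in `k`; letting `c → 0` makes the
limit set null. -/

theorem distInt_eq_norm (t : ℝ) : distInt t = ‖(t : UnitAddCircle)‖ :=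
  UnitAddCircle.norm_eq.symm

theorem measurable_distInt : Measurable distInt := by
  have : distInt = fun t : ℝ => ‖(t : UnitAddCircle)‖ := funext distInt_eq_norm
  rw [this]
  exact (continuous_norm.comp (AddCircle.continuous_mk' 1)).measurable

theorem measurable_wnorm {d : ℕ} (r : Fin d → ℝ) : Measurable (wnorm r) := by
  unfold wnorm
  refine (Measurable.iSup fun i => ?_).pow_const _
  split_ifs
  · exact measurable_const
  · exact (measurable_distInt.comp (measurable_pi_apply i)).pow_const _

theorem iSup_weights_nonneg {d : ℕ} (r x : Fin d → ℝ) :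
    0 ≤ ⨆ i : Fin d, if r i = 0 then 0 else distInt (x i) ^ (1 / r i) := by
  refine Real.iSup_nonneg fun i => ?_
  split_ifs
  · exact le_rfl
  · exact Real.rpow_nonneg (abs_nonneg _) _

theorem wnorm_nonneg {d : ℕ} (r x : Fin d → ℝ) : 0 ≤ wnorm r x :=
  Real.rpow_nonneg (iSup_weights_nonneg r x) _

theorem distInt_lt_of_wnorm_pow_lt {d : ℕ} {r x : Fin d → ℝ} {ε : ℝ} (hd : d ≠ 0)
    (h : wnorm r x ^ d < ε) {i : Fin d} (hi : 0 < r i) : distInt (x i) < ε ^ r i := by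
  have hpow : wnorm r x ^ d = ⨆ i : Fin d, if r i = 0 then 0 else distInt (x i) ^ (1 / r i) := by
    rw [wnorm, one_div, Real.rpow_inv_natCast_pow (iSup_weights_nonneg r x) hd]
  rw [hpow] at h
  have hle := le_ciSup (Finite.bddAbove_range
    fun i : Fin d => if r i = 0 then 0 else distInt (x i) ^ (1 / r i)) i
  simp only [hi.ne', if_false] at hle
  have hlt := hle.trans_lt h
  have h0 : 0 ≤ distInt (x i) := abs_nonneg _
  calc distInt (x i) = (distInt (x i) ^ (1 / r i)) ^ r i := by
        rw [← Real.rpow_mul h0, one_div_mul_cancel hi.ne', Real.rpow_one]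
    _ < ε ^ r i := Real.rpow_lt_rpow (Real.rpow_nonneg h0 _) hlt hi

theorem volume_distInt_add_lt_le (a s η : ℝ) :
    volume ({t | distInt (s + t) < η} ∩ Set.Ioc a (a + 1)) ≤ ENNReal.ofReal (2 * η) := by
  have hmp := UnitAddCircle.measurePreserving_mk a
  have hsub : {t : ℝ | distInt (s + t) < η} ⊆
      (fun t : ℝ => (t : UnitAddCircle)) ⁻¹' Metric.closedBall (-(s : UnitAddCircle)) η := by
    intro t ht
    have : distInt (s + t) ≤ η := le_of_lt ht
    rw [distInt_eq_norm, AddCircle.coe_add] at this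
    simpa [dist_eq_norm, add_comm] using this
  calc volume ({t | distInt (s + t) < η} ∩ Set.Ioc a (a + 1))
      ≤ volume ((fun t : ℝ => (t : UnitAddCircle)) ⁻¹'
          Metric.closedBall (-(s : UnitAddCircle)) η ∩ Set.Ioc a (a + 1)) :=
        measure_mono (Set.inter_subset_inter_left _ hsub)
    _ ≤ (volume.restrict (Set.Ioc a (a + 1))) ((fun t : ℝ => (t : UnitAddCircle)) ⁻¹'
          Metric.closedBall (-(s : UnitAddCircle)) η) := Measure.le_restrict_apply _ _
    _ = volume (Metric.closedBall (-(s : UnitAddCircle)) η) :=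
        hmp.measure_preimage Metric.isClosed_closedBall.measurableSet.nullMeasurableSet
    _ ≤ ENNReal.ofReal (2 * η) := by
        rw [AddCircle.volume_closedBall]
        exact ENNReal.ofReal_le_ofReal (min_le_right _ _)

/-- The unit cube with corner `a`. -/
def unitCube {d : ℕ} (a : Fin d → ℤ) : Set (Fin d → ℝ) :=
  Set.univ.pi fun i => Set.Ioc (a i : ℝ) (a i + 1)

theorem iUnion_unitCube (d : ℕ) : ⋃ a : Fin d → ℤ, unitCube a = Set.univ := by
  refine Set.eq_univ_of_forall fun y => Set.mem_iUnion.2 ⟨fun i => ⌈y i⌉ - 1, fun i _ => ?_⟩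
  have h1 := Int.le_ceil (y i)
  have h2 := Int.ceil_lt_add_one (y i)
  constructor <;> push_cast <;> linarith

theorem volume_wnorm_pow_lt_le {d : ℕ} {r : Fin d → ℝ} (hr : r ∈ stdSimplex ℝ (Fin d))
    (hd : d ≠ 0) (a : Fin d → ℤ) (s : Fin d → ℝ) {ε : ℝ} (hε : 0 < ε) :
    volume ({y | wnorm r (s + y) ^ d < ε} ∩ unitCube a) ≤ ENNReal.ofReal (2 ^ d * ε) := by
  have hsub : {y | wnorm r (s + y) ^ d < ε} ∩ unitCube a ⊆ Set.univ.pi fun i =>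
      {t | 0 < r i → distInt (s i + t) < ε ^ r i} ∩ Set.Ioc (a i : ℝ) (a i + 1) :=
    fun y hy i _ => ⟨fun hi => distInt_lt_of_wnorm_pow_lt hd hy.1 hi, hy.2 i trivial⟩
  have hfac (i : Fin d) : volume ({t | 0 < r i → distInt (s i + t) < ε ^ r i} ∩
      Set.Ioc (a i : ℝ) (a i + 1)) ≤ ENNReal.ofReal (2 * ε ^ r i) := by
    rcases (hr.1 i).eq_or_lt with h0 | hi
    -- A zero weight imposes no condition: the whole unit interval has length `1 ≤ 2 * ε ^ 0`.
    · refine (measure_mono Set.inter_subset_right).trans ?_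
      rw [Real.volume_Ioc, ← h0]
      exact ENNReal.ofReal_le_ofReal (by norm_num)
    · simpa [hi] using volume_distInt_add_lt_le (a i) (s i) (ε ^ r i)
  calc volume ({y | wnorm r (s + y) ^ d < ε} ∩ unitCube a)
      ≤ ∏ i, ENNReal.ofReal (2 * ε ^ r i) := by
        refine (measure_mono hsub).trans ?_
        rw [volume_pi_pi]
        exact Finset.prod_le_prod' fun i _ => hfac i
    _ = ENNReal.ofReal (2 ^ d * ε) := by
        -- The weights sum to `1`, so the powers of `ε` multiply to `ε`.
        rw [← ENNReal.ofReal_prod_of_nonneg fun i _ => by positivity, Finset.prod_mul_distrib,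
          ← Real.rpow_sum_of_pos hε, hr.2]
        simp

/-- The running minimum of `‖m x + y‖_r` over `0 ≤ m ≤ n`. -/
noncomputable def runningMin {d : ℕ} (r : Fin d → ℝ) (p : (Fin d → ℝ) × (Fin d → ℝ)) (n : ℕ) : ℝ≥0 :=
  (Finset.range (n + 1)).inf' Finset.nonempty_range_add_one
    fun m => (wnorm r ((m : ℝ) • p.1 + p.2)).toNNReal

section

variable {d : ℕ} {r : Fin d → ℝ}

theorem antitone_runningMin (p : (Fin d → ℝ) × (Fin d → ℝ)) : Antitone (runningMin r p) :=
  fun _ _ h => Finset.inf'_mono _ (Finset.range_mono (by omega)) _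

theorem measurable_runningMin (n : ℕ) : Measurable fun p => runningMin r p n := by
  have h : Measurable ((Finset.range (n + 1)).inf' Finset.nonempty_range_add_one
      fun m (p : (Fin d → ℝ) × (Fin d → ℝ)) => (wnorm r ((m : ℝ) • p.1 + p.2)).toNNReal) :=
    Finset.inf'_induction _ _ (fun _ hf _ hg => hf.inf hg) fun m _ =>
      ((measurable_wnorm r).comp (by fun_prop)).real_toNNReal
  convert h using 2 with p
  rw [Finset.inf'_apply]
  rfl

theorem summable_runningMin_pow_of_mem_PiSet {p : (Fin d → ℝ) × (Fin d → ℝ)}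
    (hp : p ∈ PiSet r) : Summable fun n => runningMin r p n ^ d := by
  by_contra hns
  have hW : p ∈ W r (runningMin r p) :=
    Set.mem_iInter₂.1 hp _ ⟨(antitone_runningMin p).antitoneOn _, hns⟩
  obtain ⟨n, -, hn⟩ := hW.nonempty
  have hle : runningMin r p n ≤ (wnorm r ((n : ℝ) • p.1 + p.2)).toNNReal :=
    Finset.inf'_le _ (Finset.self_mem_range_succ n)
  have hle' := NNReal.coe_le_coe.2 hle
  rw [Real.coe_toNNReal _ (wnorm_nonneg _ _)] at hle'
  exact absurd hn hle'.not_gt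

theorem tendsto_two_pow_mul_runningMin_pow {p : (Fin d → ℝ) × (Fin d → ℝ)} (hp : p ∈ PiSet r) :
    Tendsto (fun k : ℕ => 2 ^ k * runningMin r p (2 ^ k) ^ d) atTop (𝓝 0) := by
  have hanti : ∀ ⦃m n : ℕ⦄, 0 < m → m ≤ n → runningMin r p n ^ d ≤ runningMin r p m ^ d :=
    fun m n _ h => pow_le_pow_left' (antitone_runningMin p h) d
  have hsum := (NNReal.summable_condensed_iff (f := fun n => runningMin r p n ^ d) hanti).2
    (summable_runningMin_pow_of_mem_PiSet hp)
  exact NNReal.tendsto_atTop_zero_of_summable hsum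

theorem volume_two_pow_mul_runningMin_pow_lt_le (hr : r ∈ stdSimplex ℝ (Fin d)) (hd : d ≠ 0)
    (a : Fin d → ℤ) (x : Fin d → ℝ) {c : ℝ≥0} (hc : 0 < c) (k : ℕ) :
    volume ({y | 2 ^ k * runningMin r (x, y) (2 ^ k) ^ d < c} ∩ unitCube a) ≤
      ENNReal.ofReal (2 ^ (d + 1) * c) := by
  have hc' : (0 : ℝ) < c / 2 ^ k := by positivity
  have hsub : {y | 2 ^ k * runningMin r (x, y) (2 ^ k) ^ d < c} ∩ unitCube a ⊆
      ⋃ m ∈ Finset.range (2 ^ k + 1),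
        ({y | wnorm r ((m : ℝ) • x + y) ^ d < c / 2 ^ k} ∩ unitCube a) := by
    rintro y ⟨hy, hya⟩
    obtain ⟨m, hm, hmin⟩ := Finset.exists_mem_eq_inf' (s := Finset.range (2 ^ k + 1))
      Finset.nonempty_range_add_one fun m => (wnorm r ((m : ℝ) • x + y)).toNNReal
    have hy' : 2 ^ k * (wnorm r ((m : ℝ) • x + y)).toNNReal ^ d < c := by
      rw [← hmin]; exact hy
    have hy'' := NNReal.coe_lt_coe.2 hy'
    push_cast at hy''
    rw [Real.coe_toNNReal _ (wnorm_nonneg _ _)] at hy''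
    refine Set.mem_iUnion₂.2 ⟨m, hm, ?_, hya⟩
    rw [Set.mem_ofPred_eq, lt_div_iff₀' (by positivity)]
    exact hy''
  calc volume ({y | 2 ^ k * runningMin r (x, y) (2 ^ k) ^ d < c} ∩ unitCube a)
      ≤ ∑ m ∈ Finset.range (2 ^ k + 1),
          volume ({y | wnorm r ((m : ℝ) • x + y) ^ d < c / 2 ^ k} ∩ unitCube a) :=
        (measure_mono hsub).trans (measure_biUnion_finset_le _ _)
    _ ≤ ∑ m ∈ Finset.range (2 ^ k + 1), ENNReal.ofReal (2 ^ d * (c / 2 ^ k)) :=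
        Finset.sum_le_sum fun m _ => volume_wnorm_pow_lt_le hr hd a _ hc'
    _ = ENNReal.ofReal ((2 ^ k + 1) * (2 ^ d * (c / 2 ^ k))) := by
        rw [Finset.sum_const, Finset.card_range, ← ENNReal.ofReal_nsmul, nsmul_eq_mul]
        push_cast
        rfl
    _ ≤ ENNReal.ofReal (2 ^ (d + 1) * c) := by
        refine ENNReal.ofReal_le_ofReal ?_
        have h1 : (1 : ℝ) ≤ 2 ^ k := one_le_pow₀ (by norm_num)
        calc ((2 : ℝ) ^ k + 1) * (2 ^ d * (c / 2 ^ k))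
            ≤ (2 ^ k + 2 ^ k) * (2 ^ d * (c / 2 ^ k)) := by gcongr
          _ = 2 ^ (d + 1) * c := by field_simp; ring

theorem volume_setOf_tendsto_eq_zero (hr : r ∈ stdSimplex ℝ (Fin d)) (hd : d ≠ 0)
    (x : Fin d → ℝ) :
    volume {y | Tendsto (fun k : ℕ => 2 ^ k * runningMin r (x, y) (2 ^ k) ^ d)
      atTop (𝓝 0)} = 0 := by
  set S := {y | Tendsto (fun k : ℕ => 2 ^ k * runningMin r (x, y) (2 ^ k) ^ d) atTop (𝓝 0)}
  have hbound (a : Fin d → ℤ) (c : ℝ≥0) (hc : 0 < c) :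
      volume (S ∩ unitCube a) ≤ ENNReal.ofReal (2 ^ (d + 1) * c) := by
    let E (N : ℕ) : Set (Fin d → ℝ) :=
      {y | ∀ k ≥ N, 2 ^ k * runningMin r (x, y) (2 ^ k) ^ d < c} ∩ unitCube a
    have hmono : Monotone E := fun M N hMN y hy => ⟨fun k hk => hy.1 k (hMN.trans hk), hy.2⟩
    have hsub : S ∩ unitCube a ⊆ ⋃ N, E N := by
      rintro y ⟨hy, hya⟩
      obtain ⟨N, hN⟩ := eventually_atTop.1 (Tendsto.eventually_lt_const hc hy)
      exact Set.mem_iUnion.2 ⟨N, hN, hya⟩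
    refine (measure_mono hsub).trans ?_
    rw [hmono.measure_iUnion]
    -- The bound does not decay in `k`, but being uniform it passes to the increasing union: `E N`
    -- lies in the single event `k = N`.
    refine iSup_le fun N => (measure_mono ?_).trans
      (volume_two_pow_mul_runningMin_pow_lt_le hr hd a x hc N)
    exact fun y hy => ⟨hy.1 N le_rfl, hy.2⟩
  have hcube (a : Fin d → ℤ) : volume (S ∩ unitCube a) = 0 := by
    refine le_antisymm (ENNReal.le_of_forall_pos_le_add fun ε hε _ => ?_) zero_le
    refine (hbound a (ε / 2 ^ (d + 1)) (by positivity)).trans (le_of_eq ?_)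
    push_cast
    rw [mul_div_cancel₀ _ (by positivity), ENNReal.ofReal_coe_nnreal, zero_add]
  rw [← Set.inter_univ S, ← iUnion_unitCube d, Set.inter_iUnion]
  exact measure_iUnion_null hcube

end

end WeightedApprox

theorem mainTheorem4 {d : ℕ} (r : Fin d → ℝ) (hr : r ∈ stdSimplex ℝ (Fin d)) :
    (NullMeasurableSet (WeightedApprox.PiSet r)
        (volume : Measure ((Fin d → ℝ) × (Fin d → ℝ))) ∧
      volume (WeightedApprox.PiSet r) = 0) ∧
    ∀ x : Fin d → ℝ, volume (WeightedApprox.PhiSet r x) = 0 := by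
  have hd : d ≠ 0 := by
    rintro rfl
    simpa using hr.2
  have hfiber := WeightedApprox.volume_setOf_tendsto_eq_zero hr hd
  have hnull : volume (WeightedApprox.PiSet r) = 0 := by
    -- `Π_r` is an uncountable intersection, so Fubini is applied to this measurable superset.
    have hmeas : MeasurableSet {p | Tendsto (fun k : ℕ =>
        2 ^ k * WeightedApprox.runningMin r p (2 ^ k) ^ d) atTop (𝓝 0)} :=
      measurableSet_tendsto _ fun k =>
        ((WeightedApprox.measurable_runningMin _).pow_const d).const_mul _
    refine measure_mono_null (fun p hp => WeightedApprox.tendsto_two_pow_mul_runningMin_pow hp)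
      ((Measure.measure_prod_null hmeas).2 (ae_of_all _ hfiber))
  exact ⟨⟨NullMeasurableSet.of_null hnull, hnull⟩, fun x => measure_mono_null
    (fun y hy => WeightedApprox.tendsto_two_pow_mul_runningMin_pow hy) (hfiber x)⟩
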